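/- Fix an inverse temperature $\beta\ge 0$. For a finite $\Lambda\subset\mathbb Z^2$, let $\partial\Lambda$ be the set of sites outside $\Lambda$ at unit distance from $\Lambda$. For a boundary condition $\tau\in\{-1,1\}^{\partial\Lambda}$ let $\pi^\tau_\Lambda(\sigma)\propto e^{-\beta H^\tau(\sigma)}$ on $\{-1,1\}^\Lambda$, where $$H^\tau(\sigma)=-\tfrac12\sum_{x,y\in\Lambda,\ |x-y|=1}\sigma_x\sigma_y-\sum_{x\in\Lambda,\ y\in\partial\Lambda,\ |x-y|=1}\sigma_x\tau_y ,$$ be the Ising Gibbs measure. Let $\mu^\sigma_t$ be the law at time $t$, started from $\sigma$, of the continuous-time heat-bath dynamics, in which each spin is resampled at rate one from its conditional law under $\pi^\tau_\Lambda$ given the other spins; write $\mu^+_t$ and $\mu^-_t$ for the initial conditions identically $+1$ and $-1$. Let $\|\mu-\nu\|=\frac12\sum_\sigma|\mu(\sigma)-\nu(\sigma)|$ and $T_{\rm mix}=\inf\{t>0:\sup_\sigma\|\mu^\sigma_t-\pi^\tau_\Lambda\|\le 1/(2e)\}$. Let $\pi^{+}_\infty$ and $\pi^-_\infty$ be the plus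 and minus phases on $\mathbb Z^2$, that is, the weak limits of the Gibbs measures in growing boxes with boundary conditions identically $+1$ and $-1$. For $\varepsilon>0$ and an integer $L\ge1$ let $$R^\varepsilon_L=\{1,\dots,L\}\times\{1,\dots,\lceil L^{1/2+\varepsilon}\rceil\},\qquad Q^\varepsilon_L=\{1,\dots,L\}\times\{1,\dots,\lceil(2L+1)^{1/2+\varepsilon}\rceil\}.$$ For such a rectangle $R$ let $\mathcal D(R)$ be the set of probability laws $\mathbf P$ of boundary conditions on $\partial R$ whose marginal on the union of the North, East and West borders is stochastically dominated by the marginal of $\pi^-_\infty$, and whose marginal on the South border stochastically dominates the marginal of $\pi^+_\infty$. We say that $\mathcal A(L,t,\delta)$ holds if $\mathbf E\|\mu^+_t-\pi^\tau_R\|\le\delta$ and $\mathbf E\|\mu^-_t-\pi^\tau_R\|\le\delta$ for $R=R^\varepsilon_L$ and every $\mathbf P\in\mathcal D(R)$, where $\mathbf E$ is the average over $\tau$ with law $\mathbf P$. The statement $\mathcal B(L,t,\delta)$ is the same with $R=Q^\varepsilon_L$. **Proposition.** For every $\beta\ge0$ and every $\varepsilon_0>0$ there is a constant $c=c(\beta,\varepsilon_0)>0$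 such that for every $0<\varepsilon\le\varepsilon_0$ and every integer $L\ge1$: $T_{\rm mix}\le e^{cL}$ for every boundary condition $\tau$, both on $R^\varepsilon_L$ and on $Q^\varepsilon_L$; and for every $t\ge e^{cL}$ the statements $$\mathcal A\bigl(L,t,e^{-t\,e^{-cL}}\bigr)\quad\text{and}\quad\mathcal B\bigl(L,t,e^{-t\,e^{-cL}}\bigr)$$ hold. -/

import Mathlib

open MeasureTheory Filter Topology

noncomputable section

namespace Ising

/-- Sites of the square lattice. -/
abbrev Site := ℤ × ℤ

/-- A spin: `true` is `+1`, `false` is `-1`; the order `false < true` is the order of the spins. -/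
abbrev Spin := Bool

/-- The numerical value `±1` of a spin. -/
def spinVal (s : Spin) : ℝ := if s then 1 else -1

/-- The four nearest neighbours of a site. -/
def nbrs (x : Site) : Finset Site :=
  {(x.1 + 1, x.2), (x.1 - 1, x.2), (x.1, x.2 + 1), (x.1, x.2 - 1)}

/-- The boundary of `Λ`: the sites outside `Λ` at unit distance from `Λ`. -/
def boundary (Λ : Finset Site) : Finset Site := Λ.biUnion nbrs \ Λ

/-- Spin configurations on a finite set of sites, with the pointwise order. -/
abbrev Config (Λ : Finset Site) := Λ → Spin

/-- The Ising Hamiltonian in `Λ` with boundary condition `τ` on `∂Λ`. -/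
def hamiltonian (Λ : Finset Site) (τ : Config (boundary Λ)) (σ : Config Λ) : ℝ :=
  -(1 / 2) * (∑ x : Λ, ∑ y : Λ, if (y : Site) ∈ nbrs x then spinVal (σ x) * spinVal (σ y) else 0)
    - ∑ x : Λ, ∑ y : boundary Λ, if (y : Site) ∈ nbrs x then spinVal (σ x) * spinVal (τ y) else 0

/-- The partition function. -/
def partitionFn (β : ℝ) (Λ : Finset Site) (τ : Config (boundary Λ)) : ℝ :=
  ∑ σ : Config Λ, Real.exp (-β * hamiltonian Λ τ σ)

/-- The Gibbs measure `π_Λ^τ`, as a probability mass function. -/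
def gibbs (β : ℝ) (Λ : Finset Site) (τ : Config (boundary Λ)) (σ : Config Λ) : ℝ :=
  Real.exp (-β * hamiltonian Λ τ σ) / partitionFn β Λ τ

/-- The Gibbs average over the spin at `x` given all the other spins of `σ`, as a transition
matrix: the probability that `σ` becomes `η` when the spin at `x` is refreshed. -/
def heatBath (β : ℝ) (Λ : Finset Site) (τ : Config (boundary Λ)) (x : Λ) (σ η : Config Λ) : ℝ :=
  if ∀ y, y ≠ x → η y = σ y then
    gibbs β Λ τ η / ∑ s : Spin, gibbs β Λ τ (Function.update σ x s)
  else 0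

/-- The generator of the heat-bath dynamics in `Λ`: every spin is refreshed at rate one. -/
def generator (β : ℝ) (Λ : Finset Site) (τ : Config (boundary Λ)) :
    Matrix (Config Λ) (Config Λ) ℝ :=
  Matrix.of fun σ η => ∑ x : Λ, (heatBath β Λ τ x σ η - if η = σ then 1 else 0)

/-- The distribution `μ_t^σ` at time `t` of the heat-bath dynamics started from `σ`: row `σ` of
the semigroup `exp (t 𝓛)`. -/
def law (β : ℝ) (Λ : Finset Site) (τ : Config (boundary Λ)) (t : ℝ) (σ : Config Λ) :
    Config Λ → ℝ :=
  NormedSpace.exp (t • generator β Λ τ) σ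

/-- Total variation distance between two probability mass functions. -/
def tvDist {Ω : Type*} [Fintype Ω] (μ ν : Ω → ℝ) : ℝ := (1 / 2) * ∑ ω, |μ ω - ν ω|

/-- The mixing time `T_mix(δ)`, with value `∞` if no time qualifies. -/
def mixingTimeAt (β : ℝ) (Λ : Finset Site) (τ : Config (boundary Λ)) (δ : ℝ) : ENNReal :=
  sInf (ENNReal.ofReal ''
    {t : ℝ | 0 < t ∧ ∀ σ : Config Λ, tvDist (law β Λ τ t σ) (gibbs β Λ τ) ≤ δ})

/-- The mixing time `T_mix = T_mix(1 / (2e))`. -/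
def mixingTime (β : ℝ) (Λ : Finset Site) (τ : Config (boundary Λ)) : ENNReal :=
  mixingTimeAt β Λ τ (1 / (2 * Real.exp 1))

/-- The square box of side `2n + 1` centred at the origin. -/
def box (n : ℕ) : Finset Site :=
  Finset.Icc (-(n : ℤ)) n ×ˢ Finset.Icc (-(n : ℤ)) n

/-- A configuration in `Λ`, continued by the constant value `s` outside `Λ`. -/
def extend (Λ : Finset Site) (s : Spin) (σ : Config Λ) : Site → Spin :=
  fun x => if h : x ∈ Λ then σ ⟨x, h⟩ else s

theorem partitionFn_pos (β : ℝ) (Λ : Finset Site) (τ : Config (boundary Λ)) :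
    0 < partitionFn β Λ τ :=
  Finset.sum_pos (fun _ _ => Real.exp_pos _) Finset.univ_nonempty

theorem gibbs_nonneg (β : ℝ) (Λ : Finset Site) (τ : Config (boundary Λ)) (σ : Config Λ) :
    0 ≤ gibbs β Λ τ σ :=
  div_nonneg (Real.exp_pos _).le (partitionFn_pos β Λ τ).le

theorem sum_gibbs (β : ℝ) (Λ : Finset Site) (τ : Config (boundary Λ)) :
    ∑ σ : Config Λ, gibbs β Λ τ σ = 1 := by
  simp only [gibbs]
  rw [← Finset.sum_div]
  exact div_self (partitionFn_pos β Λ τ).ne'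

/-- The Gibbs measure in `Λ` with constant boundary condition `s`, as a measure on the
configurations of the whole lattice (equal to `s` outside `Λ`). -/
def constGibbs (β : ℝ) (s : Spin) (Λ : Finset Site) : ProbabilityMeasure (Site → Spin) :=
  ⟨∑ σ : Config Λ,
      ENNReal.ofReal (gibbs β Λ (fun _ => s) σ) • Measure.dirac (extend Λ s σ), by
    constructor
    simp only [Measure.coe_finsetSum, Finset.sum_apply, Measure.smul_apply, measure_univ,
      smul_eq_mul, mul_one]
    rw [← ENNReal.ofReal_sum_of_nonneg (fun σ _ => gibbs_nonneg _ _ _ σ), sum_gibbs,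
      ENNReal.ofReal_one]⟩

/-- The plus phase (`s = true`) or minus phase (`s = false`) on the whole lattice: the weak limit,
as the box fills the lattice, of the Gibbs measures with constant boundary condition `s`. -/
def phase (β : ℝ) (s : Spin) : ProbabilityMeasure (Site → Spin) :=
  haveI : Nonempty (ProbabilityMeasure (Site → Spin)) := ⟨constGibbs β s ∅⟩
  limUnder atTop fun n : ℕ => constGibbs β s (box n)

/-- Stochastic domination `μ ⪯ ν` for measures on the configurations of a finite set. -/
def StochLE {V : Finset Site} (μ ν : Measure (Config V)) : Prop :=
  ∀ f : Config V → ℝ, Monotone f → ∫ σ, f σ ∂μ ≤ ∫ σ, f σ ∂ν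

/-- The rectangle `{1, …, w} × {1, …, h}`. -/
def rect (w h : ℕ) : Finset Site := Finset.Icc 1 (w : ℤ) ×ˢ Finset.Icc 1 (h : ℤ)

/-- The southern border of the rectangle. -/
def southBorder (w h : ℕ) : Finset Site := (boundary (rect w h)).filter fun x => x.2 = 0

/-- The union of the northern, eastern and western borders of the rectangle. -/
def northEastWestBorder (w h : ℕ) : Finset Site :=
  (boundary (rect w h)).filter fun x => x.2 ≠ 0

theorem southBorder_subset (w h : ℕ) : southBorder w h ⊆ boundary (rect w h) :=
  Finset.filter_subset _ _

theorem northEastWestBorder_subset (w h : ℕ) : northEastWestBorder w h ⊆ boundary (rect w h) :=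
  Finset.filter_subset _ _

/-- The marginal on `V` of a law of configurations on a larger finite set. -/
def marginal {V W : Finset Site} (hVW : V ⊆ W) (P : Measure (Config W)) : Measure (Config V) :=
  P.map (Finset.restrict₂ (π := fun _ => Spin) hVW)

/-- The marginal on `V` of the plus or minus phase. -/
def phaseMarginal (β : ℝ) (s : Spin) (V : Finset Site) : Measure (Config V) :=
  (phase β s : Measure (Site → Spin)).map (Finset.restrict (π := fun _ => Spin) V)

/-- The class `𝒟(R)` of laws of boundary conditions for the rectangle `R = rect w h`: below the
minus phase on the northern, eastern and western borders and above the plus phase on the southern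
border. -/
def classD (β : ℝ) (w h : ℕ) (P : Measure (Config (boundary (rect w h)))) : Prop :=
  IsProbabilityMeasure P ∧
  StochLE (marginal (northEastWestBorder_subset w h) P)
    (phaseMarginal β false (northEastWestBorder w h)) ∧
  StochLE (phaseMarginal β true (southBorder w h)) (marginal (southBorder_subset w h) P)

/-- In the rectangle, for every law in `𝒟`, the mean distance from equilibrium at time `t` is at
most `δ`, both from the all plus and from the all minus initial condition. -/
def inductiveStatement (β : ℝ) (w h : ℕ) (t δ : ℝ) : Prop :=
  ∀ P : Measure (Config (boundary (rect w h))), classD β w h P →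
    ∀ s : Spin,
      ∫ τ, tvDist (law β (rect w h) τ t fun _ => s) (gibbs β (rect w h) τ) ∂P ≤ δ

/-- Height of `R_L^ε`. -/
def heightR (ε : ℝ) (L : ℕ) : ℕ := ⌈(L : ℝ) ^ (1 / 2 + ε)⌉₊

/-- Height of `Q_L^ε`. -/
def heightQ (ε : ℝ) (L : ℕ) : ℕ := ⌈(2 * (L : ℝ) + 1) ^ (1 / 2 + ε)⌉₊

/-- The rectangle `R_L^ε`. -/
abbrev rectR (ε : ℝ) (L : ℕ) : Finset Site := rect L (heightR ε L)

/-- The rectangle `Q_L^ε`. -/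
abbrev rectQ (ε : ℝ) (L : ℕ) : Finset Site := rect L (heightQ ε L)

/-- The statement `𝒜(L, t, δ)`. -/
def statementA (β ε : ℝ) (L : ℕ) (t δ : ℝ) : Prop := inductiveStatement β L (heightR ε L) t δ

/-- The statement `ℬ(L, t, δ)`. -/
def statementB (β ε : ℝ) (L : ℕ) (t δ : ℝ) : Prop := inductiveStatement β L (heightQ ε L) t δ

end Ising

end

/-! Heat-bath dynamics is reversible, so a Poincaré inequality with constant K makes the chi-square
distance from equilibrium decay like e^{-2t/K} (`tvDist_exp_smul_le`). Its initial value is at most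
1/π(σ), an exponential in the number of sites (`one_div_gibbs_le`).

The constant K comes from a canonical-path argument (`variance_le_sum_flip`). Enumerate the sites
and turn σ into η by replacing one spin after another. Each intermediate configuration, paired with
the complementary splice of σ and η, determines (σ, η), and passing to this pair costs only the
energy along the cut. Enumerated by rows, a rectangle of base L has cuts of width L whatever its
height, so K is e^{O(L)} times the number of steps.

For ε ≤ ε₀ the height is polynomial in L, with a degree bounded in terms of ε₀, so one c absorbs
every factor. The bound holds for each boundary condition and initial state, and hence survives
averaging over any probability law of τ. -/

namespace Ising

/-! ### Reversible generators: from a Poincaré inequality to decay in total variation. -/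

section Reversible

variable {Ω : Type*} [Fintype Ω]

/-- Expand the square: zero row sums kill the `f σ ^ 2` term, reversibility turns the `f η ^ 2` term
into that one, and only the cross term remains. -/
theorem sum_sum_mul_sq_sub_eq {p : Ω → ℝ} {G : Matrix Ω Ω ℝ} (hrow : ∀ σ, ∑ η, G σ η = 0)
    (hrev : ∀ σ η, p σ * G σ η = p η * G η σ) (f : Ω → ℝ) :
    ∑ σ, ∑ η, p σ * G σ η * (f η - f σ) ^ 2 = -2 * ∑ σ, p σ * f σ * ∑ η, G σ η * f η := by
  have h1 : ∑ σ, ∑ η, p σ * G σ η * f σ ^ 2 = 0 := by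
    refine Finset.sum_eq_zero fun σ _ => ?_
    rw [← Finset.sum_mul, ← Finset.mul_sum, hrow, mul_zero, zero_mul]
  have h2 : ∑ σ, ∑ η, p σ * G σ η * f η ^ 2 = 0 := by
    rw [Finset.sum_comm, ← h1]
    exact Finset.sum_congr rfl fun σ _ => Finset.sum_congr rfl fun η _ => by rw [hrev]
  calc ∑ σ, ∑ η, p σ * G σ η * (f η - f σ) ^ 2
      = ∑ σ, ∑ η, p σ * G σ η * f η ^ 2 + ∑ σ, ∑ η, p σ * G σ η * f σ ^ 2
          - 2 * ∑ σ, ∑ η, p σ * f σ * (G σ η * f η) := by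
        simp only [Finset.mul_sum, ← Finset.sum_add_distrib, ← Finset.sum_sub_distrib]
        exact Finset.sum_congr rfl fun σ _ => Finset.sum_congr rfl fun η _ => by ring
    _ = _ := by
        rw [h1, h2]; simp only [Finset.mul_sum]; simp

/-- Writes the variance as a double sum over pairs, the form in which paths between two
configurations bound it. -/
theorem sum_sum_mul_mul_sq_sub_eq {p : Ω → ℝ} (hp : ∑ σ, p σ = 1) {f : Ω → ℝ}
    (hf : ∑ σ, p σ * f σ = 0) :
    ∑ σ, ∑ η, p σ * p η * (f η - f σ) ^ 2 = 2 * ∑ σ, p σ * f σ ^ 2 := by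
  have h (σ : Ω) : ∑ η, p σ * p η * (f η - f σ) ^ 2
      = p σ * (∑ η, p η * f η ^ 2) - 2 * (p σ * f σ) * (∑ η, p η * f η)
        + p σ * f σ ^ 2 * ∑ η, p η := by
    simp only [Finset.mul_sum, ← Finset.sum_add_distrib, ← Finset.sum_sub_distrib]
    exact Finset.sum_congr rfl fun η _ => by ring
  simp only [h, hf, hp, mul_zero, mul_one, sub_zero, Finset.sum_add_distrib, ← Finset.sum_mul]
  ring

variable [DecidableEq Ω]

theorem hasDerivAt_exp_smul_apply (G : Matrix Ω Ω ℝ) (t : ℝ) (σ η : Ω) :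
    HasDerivAt (fun t : ℝ => NormedSpace.exp (t • G) σ η)
      (∑ ξ, NormedSpace.exp (t • G) σ ξ * G ξ η) t := by
  -- The norm serves only to differentiate the exponential; the entrywise derivative does not depend
  -- on it.
  let _ : NormedRing (Matrix Ω Ω ℝ) := Matrix.linftyOpNormedRing
  let _ : NormedAlgebra ℝ (Matrix Ω Ω ℝ) := Matrix.linftyOpNormedAlgebra
  have h := hasDerivAt_exp_smul_const (𝕂 := ℝ) G t
  exact hasDerivAt_pi.1 (hasDerivAt_pi.1 h σ) η

/-- The Poincaré inequality of a reversible Markov generator gives exponential decay of the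
distance from equilibrium. -/
theorem tvDist_exp_smul_le {p : Ω → ℝ} (hpos : ∀ σ, 0 < p σ) (hp : ∑ σ, p σ = 1)
    {G : Matrix Ω Ω ℝ} (hrow : ∀ σ, ∑ η, G σ η = 0)
    (hrev : ∀ σ η, p σ * G σ η = p η * G η σ) {K : ℝ} (hK : 0 < K)
    (hP : ∀ f : Ω → ℝ, ∑ σ, ∑ η, p σ * p η * (f η - f σ) ^ 2
      ≤ K * ∑ σ, ∑ η, p σ * G σ η * (f η - f σ) ^ 2)
    {t : ℝ} (ht : 0 ≤ t) (σ : Ω) :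
    tvDist (NormedSpace.exp (t • G) σ) p ≤ 1 / 2 * (Real.exp (-(t / K)) * √(1 / p σ)) := by
  set u : ℝ → Ω → ℝ := fun t η => NormedSpace.exp (t • G) σ η with hu
  have hu' (t : ℝ) (η : Ω) : HasDerivAt (fun t => u t η) (∑ ξ, u t ξ * G ξ η) t :=
    hasDerivAt_exp_smul_apply G t σ η
  have hu0 (η : Ω) : u 0 η = if σ = η then 1 else 0 := by
    simp [hu, NormedSpace.exp_zero, Matrix.one_apply]
  have hmass (t : ℝ) : ∑ η, u t η = 1 := by
    have hd (t : ℝ) : HasDerivAt (fun t => ∑ η, u t η) 0 t := by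
      have := HasDerivAt.fun_sum (u := Finset.univ) fun η _ => hu' t η
      rw [Finset.sum_comm] at this
      simpa only [← Finset.mul_sum, hrow, mul_zero, Finset.sum_const_zero] using this
    have := is_const_of_deriv_eq_zero (fun t => (hd t).differentiableAt) (fun t => (hd t).deriv) t 0
    rw [this]; simp [hu0]
  set g : ℝ → Ω → ℝ := fun t η => u t η / p η - 1 with hg
  have hpg (t : ℝ) (η : Ω) : p η * g t η = u t η - p η := by
    have := (hpos η).ne'
    simp only [hg]; field_simp
  have hmean (t : ℝ) : ∑ η, p η * g t η = 0 := by
    simp only [hpg, Finset.sum_sub_distrib, hmass, hp, sub_self]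
  -- Reversibility turns the forward equation for the law into the backward equation for its density
  -- relative to `p`.
  have hflow (t : ℝ) (η : Ω) : ∑ ξ, u t ξ * G ξ η = p η * ∑ ξ, G η ξ * g t ξ := by
    have h1 (ξ : Ω) : u t ξ * G ξ η = p η * (G η ξ * g t ξ) + p η * G η ξ := by
      linear_combination (g t ξ + 1) * hrev ξ η - G ξ η * hpg t ξ
    simp only [h1, Finset.sum_add_distrib, ← Finset.mul_sum, hrow, mul_zero, add_zero]
  set φ : ℝ → ℝ := fun t => ∑ η, p η * g t η ^ 2 with hφ
  have hφ' (t : ℝ) : HasDerivAt φ (-∑ ξ, ∑ η, p ξ * G ξ η * (g t η - g t ξ) ^ 2) t := by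
    have h1 (η : Ω) : HasDerivAt (fun t => p η * g t η ^ 2)
        (2 * (p η * g t η * ∑ ξ, G η ξ * g t ξ)) t := by
      have h2 := ((((hu' t η).div_const (p η)).sub_const 1).fun_pow 2).const_mul (p η)
      refine h2.congr_deriv ?_
      have := (hpos η).ne'
      rw [hflow]
      change p η * (((2 : ℕ) : ℝ) * g t η ^ 1 * _) = _
      field_simp
      push_cast
      ring
    have h3 := HasDerivAt.fun_sum (u := Finset.univ) fun η _ => h1 η
    refine h3.congr_deriv ?_
    rw [sum_sum_mul_sq_sub_eq hrow hrev, ← Finset.mul_sum]; ring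
  -- The Poincaré inequality for the mean-zero `g t` reads φ' ≤ -(2/K) φ.
  have hanti : Antitone fun t => Real.exp (2 * t / K) * φ t := by
    have hd (t : ℝ) := ((((hasDerivAt_id t).const_mul 2).div_const K).exp).mul (hφ' t)
    refine antitone_of_deriv_nonpos (fun t => (hd t).differentiableAt) fun t => ?_
    have h1 := (hd t).deriv
    simp only [id] at h1
    refine (le_of_eq h1).trans ?_
    have h2 := hP (g t)
    rw [sum_sum_mul_mul_sq_sub_eq hp (hmean t)] at h2
    have h3 : 2 / K * φ t ≤ ∑ ξ, ∑ η, p ξ * G ξ η * (g t η - g t ξ) ^ 2 := by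
      rw [div_mul_eq_mul_div, div_le_iff₀ hK]; linarith
    have h4 := mul_le_mul_of_nonneg_left h3 (Real.exp_pos (2 * t / K)).le
    linarith [h4]
  have hφ0 : φ 0 ≤ 1 / p σ := by
    have h1 : φ 0 = ∑ η, (u 0 η * u 0 η / p η - 2 * u 0 η + p η) := by
      refine Finset.sum_congr rfl fun η _ => ?_
      have := (hpos η).ne'
      simp only [hg]; field_simp; ring
    rw [h1, Finset.sum_add_distrib, Finset.sum_sub_distrib, ← Finset.mul_sum, hmass, hp]
    simp only [hu0, mul_ite, mul_one, mul_zero, ite_div, zero_div, Finset.sum_ite_eq,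
      Finset.mem_univ, if_true]
    linarith
  have hdecay : φ t ≤ Real.exp (-(t / K)) ^ 2 * (1 / p σ) := by
    have h1 := hanti ht
    simp only [mul_zero, zero_div, Real.exp_zero, one_mul] at h1
    have h2 : Real.exp (-(t / K)) ^ 2 * Real.exp (2 * t / K) = 1 := by
      rw [← Real.exp_nat_mul, ← Real.exp_add, Real.exp_eq_one_iff]
      push_cast; ring
    calc φ t = Real.exp (-(t / K)) ^ 2 * (Real.exp (2 * t / K) * φ t) := by
          rw [← mul_assoc, h2, one_mul]
      _ ≤ _ := by gcongr; exact h1.trans hφ0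
  -- Cauchy–Schwarz, with |u - p| = √p · (√p |g|) and total mass one.
  have hl1 : (∑ η, |u t η - p η|) ^ 2 ≤ φ t := by
    have h1 := Finset.sum_mul_sq_le_sq_mul_sq Finset.univ (fun η => √(p η))
      (fun η => √(p η) * |g t η|)
    have h2 (η : Ω) : √(p η) * (√(p η) * |g t η|) = |u t η - p η| := by
      rw [← mul_assoc, Real.mul_self_sqrt (hpos η).le, ← hpg, abs_mul, abs_of_pos (hpos η)]
    have h3 (η : Ω) : (√(p η) * |g t η|) ^ 2 = p η * g t η ^ 2 := by
      rw [mul_pow, Real.sq_sqrt (hpos η).le, sq_abs]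
    simp only [h2, h3, fun η => Real.sq_sqrt (hpos η).le, hp, one_mul] at h1
    exact h1
  have : ∑ η, |u t η - p η| ≤ Real.exp (-(t / K)) * √(1 / p σ) := by
    refine le_of_sq_le_sq ?_ (by positivity)
    rw [mul_pow, Real.sq_sqrt (one_div_pos.2 (hpos σ)).le]
    exact hl1.trans hdecay
  unfold tvDist
  exact mul_le_mul_of_nonneg_left this (by norm_num)

end Reversible

/-! ### Energy and Gibbs weight bounds. -/

variable {β : ℝ} {Λ : Finset Site} {τ : Config (boundary Λ)}

theorem gibbs_pos (β : ℝ) (Λ : Finset Site) (τ : Config (boundary Λ)) (σ : Config Λ) :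
    0 < gibbs β Λ τ σ :=
  div_pos (Real.exp_pos _) (partitionFn_pos β Λ τ)

theorem abs_spinVal (s : Spin) : |spinVal s| = 1 := by
  cases s <;> simp [spinVal]

theorem abs_spinVal_mul (s r : Spin) : |spinVal s * spinVal r| = 1 := by
  rw [abs_mul, abs_spinVal, abs_spinVal, one_mul]

theorem card_nbrs_le (x : Site) : (nbrs x).card ≤ 4 := Finset.card_le_four

theorem mem_nbrs_comm {x y : Site} : y ∈ nbrs x ↔ x ∈ nbrs y := by
  obtain ⟨a, b⟩ := x
  obtain ⟨c, d⟩ := y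
  simp only [nbrs, Finset.mem_insert, Finset.mem_singleton, Prod.mk.injEq]
  omega

/-- A sum over the neighbours in `V` of a site has at most four terms. -/
theorem sum_nbrs_le {V : Finset Site} (x : Site) {C : ℝ} (hC : 0 ≤ C) :
    ∑ y : V, (if (y : Site) ∈ nbrs x then C else 0) ≤ 4 * C := by
  rw [Finset.sum_coe_sort V fun y => if y ∈ nbrs x then C else 0, ← Finset.sum_filter,
    Finset.sum_const, nsmul_eq_mul]
  refine mul_le_mul_of_nonneg_right ?_ hC
  have : (V.filter fun y => y ∈ nbrs x) ⊆ nbrs x := fun y hy => (Finset.mem_filter.1 hy).2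
  exact_mod_cast (Finset.card_le_card this).trans (card_nbrs_le x)

theorem abs_ite_le {p : Prop} [Decidable p] {a C : ℝ} (h : |a| ≤ C) :
    |if p then a else 0| ≤ if p then C else 0 := by
  split_ifs <;> simp [h]

/-- Each site has at most four neighbours: the interior sum, taken with factor 1/2, gives 2 per site
and the boundary sum 4. -/
theorem abs_hamiltonian_le (τ : Config (boundary Λ)) (σ : Config Λ) :
    |hamiltonian Λ τ σ| ≤ 6 * Λ.card := by
  have h1 (V : Finset Site) (η : Config V) :
      |∑ x : Λ, ∑ y : V, if (y : Site) ∈ nbrs x then spinVal (σ x) * spinVal (η y) else 0|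
        ≤ 4 * Λ.card := by
    calc _ ≤ ∑ x : Λ, ∑ y : V, if (y : Site) ∈ nbrs x then (1 : ℝ) else 0 := by
          refine (Finset.abs_sum_le_sum_abs _ _).trans (Finset.sum_le_sum fun x _ =>
            (Finset.abs_sum_le_sum_abs _ _).trans (Finset.sum_le_sum fun y _ =>
              abs_ite_le (abs_spinVal_mul _ _).le))
      _ ≤ ∑ _x : Λ, (4 * 1 : ℝ) := Finset.sum_le_sum fun x _ => sum_nbrs_le _ zero_le_one
      _ = 4 * Λ.card := by simp [mul_comm]
  have h2 := abs_le.1 (h1 Λ σ)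
  have h3 := abs_le.1 (h1 (boundary Λ) τ)
  rw [hamiltonian, abs_le]
  constructor <;> linarith [h2.1, h2.2, h3.1, h3.2]

/-- The 12 is twice the energy bound 6, once for the weight and once for the partition function; the
1 comes from the 2 ≤ e states per site. -/
theorem one_div_gibbs_le (hβ : 0 ≤ β) (τ : Config (boundary Λ)) (σ : Config Λ) :
    1 / gibbs β Λ τ σ ≤ Real.exp ((1 + 12 * β) * Λ.card) := by
  have hn : (0 : ℝ) ≤ Λ.card := Nat.cast_nonneg _
  rw [gibbs, one_div_div, div_le_iff₀ (Real.exp_pos _), ← Real.exp_add]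
  have h1 : partitionFn β Λ τ ≤ 2 ^ Λ.card * Real.exp (β * (6 * Λ.card)) := by
    refine (Finset.sum_le_card_nsmul _ _ (Real.exp (β * (6 * Λ.card))) fun η _ => ?_).trans ?_
    · rw [Real.exp_le_exp]
      have := (abs_le.1 (abs_hamiltonian_le τ η)).1
      nlinarith
    · simp [Spin]
  refine h1.trans ?_
  have h2 : (2 : ℝ) ^ Λ.card ≤ Real.exp Λ.card := by
    rw [← Real.exp_one_pow]
    exact pow_le_pow_left₀ (by norm_num) (by linarith [Real.add_one_le_exp 1]) _
  refine (mul_le_mul_of_nonneg_right h2 (Real.exp_pos _).le).trans ?_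
  rw [← Real.exp_add, Real.exp_le_exp]
  have := (abs_le.1 (abs_hamiltonian_le τ σ)).2
  nlinarith

/-- Changing one spin changes the energy by a bounded amount. -/
theorem hamiltonian_update_le (τ : Config (boundary Λ)) (σ : Config Λ) (x : Λ) (s : Spin) :
    hamiltonian Λ τ (Function.update σ x s) ≤ hamiltonian Λ τ σ + 16 := by
  set η := Function.update σ x s with hη
  have hne {y : Λ} (hy : y ≠ x) : η y = σ y := Function.update_of_ne hy _ _
  have hd (a b c d : Spin) : |spinVal a * spinVal b - spinVal c * spinVal d| ≤ 2 := by
    cases a <;> cases b <;> cases c <;> cases d <;> norm_num [spinVal]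
  -- Ordered pairs count each bond at `x` twice: 2 · 4 bonds · change 2. The Hamiltonian halves this
  -- 16, and the boundary adds 8.
  have h1 : |(∑ y : Λ, ∑ z : Λ, if (z : Site) ∈ nbrs y then spinVal (η y) * spinVal (η z) else 0)
      - ∑ y : Λ, ∑ z : Λ, if (z : Site) ∈ nbrs y then spinVal (σ y) * spinVal (σ z) else 0|
      ≤ 16 := by
    rw [← Finset.sum_sub_distrib]
    calc _ ≤ ∑ y : Λ, ∑ z : Λ, ((if y = x then (if (z : Site) ∈ nbrs y then (2 : ℝ) else 0) else 0)
            + if z = x then (if (y : Site) ∈ nbrs z then (2 : ℝ) else 0) else 0) := by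
          refine (Finset.abs_sum_le_sum_abs _ _).trans (Finset.sum_le_sum fun y _ => ?_)
          rw [← Finset.sum_sub_distrib]
          refine (Finset.abs_sum_le_sum_abs _ _).trans (Finset.sum_le_sum fun z _ => ?_)
          have hcomm := mem_nbrs_comm (x := (y : Site)) (y := z)
          by_cases hyz : (z : Site) ∈ nbrs y
          · simp only [hyz, hcomm.1 hyz, if_true]
            by_cases hy : y = x
            · rw [if_pos hy]
              refine (hd _ _ _ _).trans ?_
              split_ifs <;> norm_num
            · by_cases hz : z = x
              · rw [if_pos hz, if_neg hy, zero_add]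
                exact hd _ _ _ _
              · simp [hy, hz, hne hy, hne hz]
          · simp [hyz, mt hcomm.2 hyz]
      _ = (∑ z : Λ, if (z : Site) ∈ nbrs x then (2 : ℝ) else 0)
            + ∑ y : Λ, if (y : Site) ∈ nbrs x then (2 : ℝ) else 0 := by
          simp only [Finset.sum_add_distrib]
          congr 1
          · rw [Finset.sum_comm]; simp
          · simp
      _ ≤ 4 * 2 + 4 * 2 :=
          add_le_add (sum_nbrs_le _ zero_le_two) (sum_nbrs_le _ zero_le_two)
      _ = 16 := by norm_num
  have h2 : |(∑ y : Λ, ∑ z : boundary Λ,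
        if (z : Site) ∈ nbrs y then spinVal (η y) * spinVal (τ z) else 0)
      - ∑ y : Λ, ∑ z : boundary Λ,
        if (z : Site) ∈ nbrs y then spinVal (σ y) * spinVal (τ z) else 0| ≤ 8 := by
    rw [← Finset.sum_sub_distrib]
    calc _ ≤ ∑ y : Λ, ∑ z : boundary Λ,
            (if y = x then (if (z : Site) ∈ nbrs y then (2 : ℝ) else 0) else 0) := by
          refine (Finset.abs_sum_le_sum_abs _ _).trans (Finset.sum_le_sum fun y _ => ?_)
          rw [← Finset.sum_sub_distrib]
          refine (Finset.abs_sum_le_sum_abs _ _).trans (Finset.sum_le_sum fun z _ => ?_)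
          by_cases hyz : (z : Site) ∈ nbrs y
          · simp only [hyz, if_true]
            by_cases hy : y = x
            · rw [if_pos hy]
              exact hd _ _ _ _
            · simp [hy, hne hy]
          · simp [hyz]
      _ = ∑ z : boundary Λ, if (z : Site) ∈ nbrs x then (2 : ℝ) else 0 := by
          rw [Finset.sum_comm]; simp
      _ ≤ 4 * 2 := sum_nbrs_le _ zero_le_two
      _ = 8 := by norm_num
  have h1' := abs_le.1 h1
  have h2' := abs_le.1 h2
  simp only [hamiltonian]
  linarith [h1'.1, h2'.1]

theorem gibbs_le_gibbs_update (hβ : 0 ≤ β) (τ : Config (boundary Λ)) (σ : Config Λ) (x : Λ)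
    (s : Spin) :
    gibbs β Λ τ σ ≤ Real.exp (16 * β) * gibbs β Λ τ (Function.update σ x s) := by
  simp only [gibbs]
  rw [← mul_div_assoc, ← Real.exp_add]
  refine div_le_div_of_nonneg_right (Real.exp_le_exp.2 ?_) (partitionFn_pos β Λ τ).le
  nlinarith [hamiltonian_update_le τ σ x s]

/-! ### Reversibility and spin-flip rates of the heat bath. -/

theorem heatBath_nonneg (x : Λ) (σ η : Config Λ) : 0 ≤ heatBath β Λ τ x σ η := by
  unfold heatBath
  split_ifs
  · exact div_nonneg (gibbs_nonneg _ _ _ _) (Finset.sum_nonneg fun s _ => gibbs_nonneg _ _ _ _)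
  · exact le_rfl

theorem agree_off_iff {x : Λ} {σ η : Config Λ} :
    (∀ y, y ≠ x → η y = σ y) ↔ ∃ s, η = Function.update σ x s := by
  constructor
  · intro h
    refine ⟨η x, funext fun y => ?_⟩
    by_cases hy : y = x
    · subst hy; simp
    · rw [Function.update_of_ne hy, h y hy]
  · rintro ⟨s, rfl⟩ y hy
    exact Function.update_of_ne hy _ _

theorem heatBath_update (x : Λ) (σ : Config Λ) (s : Spin) :
    heatBath β Λ τ x σ (Function.update σ x s) =
      gibbs β Λ τ (Function.update σ x s) / ∑ r : Spin, gibbs β Λ τ (Function.update σ x r) :=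
  if_pos (agree_off_iff.2 ⟨s, rfl⟩)

theorem sum_heatBath (x : Λ) (σ : Config Λ) : ∑ η, heatBath β Λ τ x σ η = 1 := by
  have hinj : Function.Injective fun s => Function.update σ x s := Function.update_injective σ x
  rw [← Finset.sum_subset (Finset.subset_univ (Finset.univ.image fun s => Function.update σ x s)),
    Finset.sum_image hinj.injOn]
  · simp only [heatBath_update]
    rw [← Finset.sum_div]
    exact div_self (Finset.sum_pos (fun _ _ => gibbs_pos _ _ _ _) Finset.univ_nonempty).ne'
  · intro η _ hη
    refine if_neg fun h => hη ?_
    obtain ⟨s, rfl⟩ := agree_off_iff.1 h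
    exact Finset.mem_image_of_mem _ (Finset.mem_univ s)

/-- Configurations that agree off `x` have the same updates at `x`, hence the same normalising sum.
-/
theorem gibbs_mul_heatBath_comm (x : Λ) (σ η : Config Λ) :
    gibbs β Λ τ σ * heatBath β Λ τ x σ η = gibbs β Λ τ η * heatBath β Λ τ x η σ := by
  by_cases h : ∀ y, y ≠ x → η y = σ y
  · have h' : ∀ y, y ≠ x → σ y = η y := fun y hy => (h y hy).symm
    obtain ⟨s, rfl⟩ := agree_off_iff.1 h
    rw [heatBath, heatBath, if_pos h, if_pos h']
    simp only [Function.update_idem]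
    ring
  · have h' : ¬∀ y, y ≠ x → σ y = η y := fun h' => h fun y hy => (h' y hy).symm
    rw [heatBath, heatBath, if_neg h, if_neg h', mul_zero, mul_zero]

theorem sum_generator (σ : Config Λ) : ∑ η, generator β Λ τ σ η = 0 := by
  simp only [generator, Matrix.of_apply]
  rw [Finset.sum_comm]
  simp [Finset.sum_sub_distrib, sum_heatBath]

theorem gibbs_mul_generator_comm (σ η : Config Λ) :
    gibbs β Λ τ σ * generator β Λ τ σ η = gibbs β Λ τ η * generator β Λ τ η σ := by
  simp only [generator, Matrix.of_apply, Finset.mul_sum, mul_sub, gibbs_mul_heatBath_comm _ σ η]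
  refine Finset.sum_congr rfl fun x _ => ?_
  by_cases h : η = σ
  · simp [h]
  · simp [h, Ne.symm h]

/-- The configuration with the spin at `x` flipped. -/
def flip (x : Λ) (σ : Config Λ) : Config Λ := Function.update σ x (!σ x)

/-- Every spin flip happens at a rate bounded below. -/
theorem one_le_heatBath_flip (hβ : 0 ≤ β) (x : Λ) (σ : Config Λ) :
    1 ≤ (1 + Real.exp (16 * β)) * heatBath β Λ τ x σ (flip x σ) := by
  have hs : ∑ r : Spin, gibbs β Λ τ (Function.update σ x r)
      = gibbs β Λ τ (flip x σ) + gibbs β Λ τ σ := by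
    have h : Function.update σ x (σ x) = σ := Function.update_eq_self x σ
    unfold flip
    rw [Fintype.sum_bool]
    cases hx : σ x <;> rw [hx] at h <;> simp [h, add_comm]
  have h : gibbs β Λ τ σ ≤ Real.exp (16 * β) * gibbs β Λ τ (flip x σ) :=
    gibbs_le_gibbs_update hβ τ σ x _
  have hb : heatBath β Λ τ x σ (flip x σ)
      = gibbs β Λ τ (flip x σ) / ∑ r : Spin, gibbs β Λ τ (Function.update σ x r) :=
    heatBath_update x σ _
  rw [hb, hs, ← mul_div_assoc, one_le_div (add_pos (gibbs_pos _ _ _ _) (gibbs_pos _ _ _ _))]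
  linarith

/-- The diagonal of the generator is invisible to the Dirichlet form, and of the nonnegative terms
of each update only the flip is kept. -/
theorem sum_flip_le_dirichlet (hβ : 0 ≤ β) (τ : Config (boundary Λ)) (f : Config Λ → ℝ) :
    ∑ σ, ∑ x : Λ, gibbs β Λ τ σ * (f (flip x σ) - f σ) ^ 2
      ≤ (1 + Real.exp (16 * β)) *
        ∑ σ, ∑ η, gibbs β Λ τ σ * generator β Λ τ σ η * (f η - f σ) ^ 2 := by
  rw [Finset.mul_sum]
  refine Finset.sum_le_sum fun σ _ => ?_
  have h1 : ∑ η, gibbs β Λ τ σ * generator β Λ τ σ η * (f η - f σ) ^ 2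
      = ∑ x : Λ, ∑ η, gibbs β Λ τ σ * heatBath β Λ τ x σ η * (f η - f σ) ^ 2 := by
    rw [Finset.sum_comm]
    refine Finset.sum_congr rfl fun η _ => ?_
    rw [← Finset.sum_mul, ← Finset.mul_sum]
    by_cases h : η = σ
    · simp [h]
    · simp [generator, h]
  rw [h1, Finset.mul_sum]
  refine Finset.sum_le_sum fun x _ => ?_
  have h2 := Finset.single_le_sum
    (f := fun η => gibbs β Λ τ σ * heatBath β Λ τ x σ η * (f η - f σ) ^ 2)
    (fun η _ => mul_nonneg (mul_nonneg (gibbs_nonneg _ _ _ _) (heatBath_nonneg _ _ _))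
      (sq_nonneg _)) (Finset.mem_univ (flip x σ))
  refine le_trans ?_ (mul_le_mul_of_nonneg_left h2 (by positivity))
  have h3 := mul_le_mul_of_nonneg_left (one_le_heatBath_flip (τ := τ) hβ x σ)
    (mul_nonneg (gibbs_nonneg β Λ τ σ) (sq_nonneg (f (flip x σ) - f σ)))
  linarith

/-! ### Canonical paths by splicing, and the Poincaré inequality. -/

/-- The configuration equal to `η` on the sites with key below `k` and to `σ` elsewhere. -/
def splice (key : Λ → ℕ) (k : ℕ) (σ η : Config Λ) : Config Λ :=
  fun x => if key x < k then η x else σ x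

theorem splice_zero (key : Λ → ℕ) (σ η : Config Λ) : splice key 0 σ η = σ := by
  funext x; simp [splice]

theorem splice_of_lt {key : Λ → ℕ} {N : ℕ} (hN : ∀ x, key x < N) (σ η : Config Λ) :
    splice key N σ η = η := by
  funext x; simp [splice, hN]

/-- Exchanging two configurations on the sites with key at least `k`. -/
def spliceEquiv (key : Λ → ℕ) (k : ℕ) : Config Λ × Config Λ ≃ Config Λ × Config Λ :=
  Function.Involutive.toPerm (fun q => (splice key k q.1 q.2, splice key k q.2 q.1)) <| by
    rintro ⟨σ, η⟩
    refine Prod.ext (funext fun x => ?_) (funext fun x => ?_) <;>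
    · simp only [splice]
      split_ifs <;> rfl

/-- At most one site has key `k`, and its spin is either kept or flipped. The indicator sum also
covers a value `k` that no site takes. -/
theorem sq_splice_succ_sub_le {key : Λ → ℕ} (hinj : Function.Injective key) (k : ℕ)
    (σ η : Config Λ) (f : Config Λ → ℝ) :
    (f (splice key (k + 1) σ η) - f (splice key k σ η)) ^ 2
      ≤ ∑ x : Λ, if key x = k then
          (f (flip x (splice key k σ η)) - f (splice key k σ η)) ^ 2 else 0 := by
  set ξ := splice key k σ η with hξ
  have hnonneg : ∀ x ∈ (Finset.univ : Finset Λ),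
      0 ≤ if key x = k then (f (flip x ξ) - f ξ) ^ 2 else 0 := fun x _ => by
    split_ifs
    · exact sq_nonneg _
    · exact le_rfl
  by_cases h : splice key (k + 1) σ η = ξ
  · rw [h, sub_self, zero_pow two_ne_zero]
    exact Finset.sum_nonneg hnonneg
  · obtain ⟨x, hx⟩ := Function.ne_iff.1 h
    have hkx : key x = k := by
      by_contra hne
      refine hx ?_
      have : key x < k + 1 ↔ key x < k := by omega
      simp only [hξ, splice, this]
    have hflip : splice key (k + 1) σ η = flip x ξ := by
      funext y
      by_cases hy : y = x
      · subst hy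
        rw [flip, Function.update_self]
        exact Bool.eq_not.2 hx
      · have hky : key y ≠ k := fun h' => hy (hinj (h'.trans hkx.symm))
        have : key y < k + 1 ↔ key y < k := by omega
        rw [flip, Function.update_of_ne hy]
        simp only [hξ, splice, this]
    rw [hflip]
    refine le_trans ?_ (Finset.single_le_sum hnonneg (Finset.mem_univ x))
    rw [if_pos hkx]

/-- Splicing two configurations costs an energy proportional to the width of the cut. -/
theorem hamiltonian_splice_le {key : Λ → ℕ} (hinj : Function.Injective key) {w : ℕ}
    (hw : ∀ x y : Λ, (y : Site) ∈ nbrs x → key y ≤ key x + w) (k : ℕ)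
    (τ : Config (boundary Λ)) (σ η : Config Λ) :
    hamiltonian Λ τ (splice key k σ η) + hamiltonian Λ τ (splice key k η σ)
      ≤ hamiltonian Λ τ σ + hamiltonian Λ τ η + 16 * w := by
  set ξ := splice key k σ η with hξ
  set ζ := splice key k η σ with hζ
  have hlow {x : Λ} (hx : key x < k) : ξ x = η x ∧ ζ x = σ x := by simp [hξ, hζ, splice, hx]
  have hhigh {x : Λ} (hx : ¬key x < k) : ξ x = σ x ∧ ζ x = η x := by simp [hξ, hζ, splice, hx]
  -- Both configurations see the same `τ`, so exchanging their spins at a site leaves the boundary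
  -- energy unchanged.
  have hbdry : (∑ x : Λ, ∑ y : boundary Λ,
        if (y : Site) ∈ nbrs x then spinVal (ξ x) * spinVal (τ y) else 0)
      + (∑ x : Λ, ∑ y : boundary Λ,
        if (y : Site) ∈ nbrs x then spinVal (ζ x) * spinVal (τ y) else 0)
      = (∑ x : Λ, ∑ y : boundary Λ,
        if (y : Site) ∈ nbrs x then spinVal (σ x) * spinVal (τ y) else 0)
      + ∑ x : Λ, ∑ y : boundary Λ,
        if (y : Site) ∈ nbrs x then spinVal (η x) * spinVal (τ y) else 0 := by
    simp only [← Finset.sum_add_distrib]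
    refine Finset.sum_congr rfl fun x _ => Finset.sum_congr rfl fun y _ => ?_
    by_cases hx : key x < k
    · rw [(hlow hx).1, (hlow hx).2, add_comm]
    · rw [(hhigh hx).1, (hhigh hx).2]
  -- Outside this strip all neighbours of a site lie on its side of the cut. Inside it, at most 2w
  -- sites with four neighbours each lose at most 4, giving 32w before the factor 1/2.
  set S : Finset Λ := Finset.univ.filter fun x => k ≤ key x + w ∧ key x < k + w with hS
  have hcard : S.card ≤ 2 * w := by
    have h1 : S.card ≤ (Finset.Ico (k - w) (k + w)).card := by
      refine Finset.card_le_card_of_injOn key (fun x hx => ?_) hinj.injOn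
      have := (Finset.mem_filter.1 hx).2
      simp only [Finset.coe_Ico, Set.mem_Ico]
      omega
    rw [Nat.card_Ico] at h1
    omega
  have hterm (x y : Λ) : (if (y : Site) ∈ nbrs x then spinVal (σ x) * spinVal (σ y) else 0)
      + (if (y : Site) ∈ nbrs x then spinVal (η x) * spinVal (η y) else 0)
      ≤ (if (y : Site) ∈ nbrs x then spinVal (ξ x) * spinVal (ξ y) else 0)
      + (if (y : Site) ∈ nbrs x then spinVal (ζ x) * spinVal (ζ y) else 0)
      + if x ∈ S then (if (y : Site) ∈ nbrs x then 4 else 0) else 0 := by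
    by_cases hxy : (y : Site) ∈ nbrs x
    · simp only [hxy, if_true]
      have h1 := hw x y hxy
      have h2 := hw y x (mem_nbrs_comm.1 hxy)
      by_cases hxS : x ∈ S
      · rw [if_pos hxS]
        have hb (a b : Spin) := abs_le.1 (abs_spinVal_mul a b).le
        linarith [(hb (σ x) (σ y)).2, (hb (η x) (η y)).2, (hb (ξ x) (ξ y)).1, (hb (ζ x) (ζ y)).1]
      · rw [if_neg hxS, add_zero]
        have h3 : ¬(k ≤ key x + w ∧ key x < k + w) := by simpa [hS] using hxS
        by_cases hx : key x < k
        · have hy : key y < k := by omega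
          rw [(hlow hx).1, (hlow hx).2, (hlow hy).1, (hlow hy).2, add_comm]
        · have hy : ¬key y < k := by omega
          rw [(hhigh hx).1, (hhigh hx).2, (hhigh hy).1, (hhigh hy).2]
    · simp [hxy]
  have hbulk := Finset.sum_le_sum fun x (_ : x ∈ Finset.univ) =>
    Finset.sum_le_sum fun y (_ : y ∈ Finset.univ) => hterm x y
  simp only [Finset.sum_add_distrib] at hbulk
  have hcut : ∑ x : Λ, ∑ y : Λ, (if x ∈ S then (if (y : Site) ∈ nbrs x then (4 : ℝ) else 0) else 0)
      ≤ 32 * w := by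
    calc _ ≤ ∑ x : Λ, if x ∈ S then (4 * 4 : ℝ) else 0 := by
          refine Finset.sum_le_sum fun x _ => ?_
          split_ifs
          · exact sum_nbrs_le _ (by norm_num)
          · simp
      _ = S.card * 16 := by
          rw [← Finset.sum_filter, Finset.sum_const, nsmul_eq_mul, Finset.filter_univ_mem]
          norm_num
      _ ≤ (2 * w : ℕ) * 16 := by gcongr
      _ = 32 * w := by push_cast; ring
  simp only [hamiltonian]
  linarith

theorem gibbs_mul_gibbs_le_splice (hβ : 0 ≤ β) {key : Λ → ℕ} (hinj : Function.Injective key)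
    {w : ℕ} (hw : ∀ x y : Λ, (y : Site) ∈ nbrs x → key y ≤ key x + w) (k : ℕ)
    (τ : Config (boundary Λ)) (σ η : Config Λ) :
    gibbs β Λ τ σ * gibbs β Λ τ η ≤ Real.exp (16 * β * w) *
      (gibbs β Λ τ (splice key k σ η) * gibbs β Λ τ (splice key k η σ)) := by
  simp only [gibbs, div_mul_div_comm]
  rw [← mul_div_assoc, ← Real.exp_add, ← Real.exp_add, ← Real.exp_add]
  refine div_le_div_of_nonneg_right (Real.exp_le_exp.2 ?_)
    (mul_pos (partitionFn_pos β Λ τ) (partitionFn_pos β Λ τ)).le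
  nlinarith [hamiltonian_splice_le hinj hw k τ σ η]

/-- Telescoping along the splices and Cauchy–Schwarz over `N` steps give the factor `N`; the cut
energy gives the exponential. -/
theorem variance_le_sum_flip (hβ : 0 ≤ β) {key : Λ → ℕ} (hinj : Function.Injective key)
    {w N : ℕ} (hw : ∀ x y : Λ, (y : Site) ∈ nbrs x → key y ≤ key x + w)
    (hN : ∀ x, key x < N) (τ : Config (boundary Λ)) (f : Config Λ → ℝ) :
    ∑ σ, ∑ η, gibbs β Λ τ σ * gibbs β Λ τ η * (f η - f σ) ^ 2
      ≤ N * Real.exp (16 * β * w) *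
        ∑ σ, ∑ x : Λ, gibbs β Λ τ σ * (f (flip x σ) - f σ) ^ 2 := by
  set E := Real.exp (16 * β * w) with hE
  set D : ℕ → Config Λ → ℝ := fun k ξ =>
    ∑ x : Λ, if key x = k then (f (flip x ξ) - f ξ) ^ 2 else 0 with hD
  have hDnonneg (k : ℕ) (ξ : Config Λ) : 0 ≤ D k ξ := Finset.sum_nonneg fun x _ => by
    split_ifs
    · exact sq_nonneg _
    · exact le_rfl
  have hpair (σ η : Config Λ) : gibbs β Λ τ σ * gibbs β Λ τ η * (f η - f σ) ^ 2
      ≤ ∑ k ∈ Finset.range N, N * E * (gibbs β Λ τ (splice key k σ η)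
          * gibbs β Λ τ (splice key k η σ) * D k (splice key k σ η)) := by
    have h1 : f η - f σ
        = ∑ k ∈ Finset.range N, (f (splice key (k + 1) σ η) - f (splice key k σ η)) := by
      rw [Finset.sum_range_sub fun k => f (splice key k σ η), splice_of_lt hN, splice_zero]
    have h2 : (f η - f σ) ^ 2 ≤ N * ∑ k ∈ Finset.range N, D k (splice key k σ η) := by
      rw [h1]
      refine sq_sum_le_card_mul_sum_sq.trans ?_
      rw [Finset.card_range]
      exact mul_le_mul_of_nonneg_left
        (Finset.sum_le_sum fun k _ => sq_splice_succ_sub_le hinj k σ η f) (Nat.cast_nonneg _)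
    have h0 := mul_nonneg (gibbs_nonneg β Λ τ σ) (gibbs_nonneg β Λ τ η)
    refine (mul_le_mul_of_nonneg_left h2 h0).trans ?_
    rw [Finset.mul_sum, Finset.mul_sum]
    refine Finset.sum_le_sum fun k _ => ?_
    have h3 := mul_le_mul_of_nonneg_right (gibbs_mul_gibbs_le_splice hβ hinj hw k τ σ η)
      (mul_nonneg (Nat.cast_nonneg (α := ℝ) N) (hDnonneg k (splice key k σ η)))
    linarith
  -- For fixed `k`, splicing both ways permutes the pairs of configurations, so the second
  -- coordinate sums out to one.
  have hstep (k : ℕ) : ∑ σ, ∑ η, gibbs β Λ τ (splice key k σ η)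
      * gibbs β Λ τ (splice key k η σ) * D k (splice key k σ η) = ∑ σ, gibbs β Λ τ σ * D k σ := by
    have h1 := Equiv.sum_comp (spliceEquiv key k)
      fun q : Config Λ × Config Λ => gibbs β Λ τ q.1 * gibbs β Λ τ q.2 * D k q.1
    rw [Fintype.sum_prod_type, Fintype.sum_prod_type] at h1
    refine h1.trans (Finset.sum_congr rfl fun σ _ => ?_)
    simp only
    rw [← Finset.sum_mul, ← Finset.mul_sum, sum_gibbs, mul_one]
  calc _ ≤ ∑ σ, ∑ η, ∑ k ∈ Finset.range N, N * E * (gibbs β Λ τ (splice key k σ η)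
          * gibbs β Λ τ (splice key k η σ) * D k (splice key k σ η)) :=
        Finset.sum_le_sum fun σ _ => Finset.sum_le_sum fun η _ => hpair σ η
    _ = N * E * ∑ k ∈ Finset.range N, ∑ σ, gibbs β Λ τ σ * D k σ := by
        simp only [← hstep, Finset.mul_sum]
        rw [Finset.sum_comm]
        refine (Finset.sum_congr rfl fun σ _ => Finset.sum_comm).trans ?_
        rw [Finset.sum_comm]
        exact Finset.sum_congr rfl fun k _ => Finset.sum_comm
    _ = _ := by
        congr 1
        rw [Finset.sum_comm]
        refine Finset.sum_congr rfl fun σ _ => ?_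
        rw [← Finset.mul_sum, ← Finset.mul_sum]
        congr 1
        simp only [hD]
        rw [Finset.sum_comm]
        refine Finset.sum_congr rfl fun x _ => ?_
        rw [Finset.sum_ite_eq, if_pos (Finset.mem_range.2 (hN x))]

/-- The Poincaré inequality of the heat-bath dynamics, with a constant exponential in the width of
the cuts of an enumeration of the sites. -/
theorem poincare (hβ : 0 ≤ β) {key : Λ → ℕ} (hinj : Function.Injective key)
    {w N : ℕ} (hw : ∀ x y : Λ, (y : Site) ∈ nbrs x → key y ≤ key x + w)
    (hN : ∀ x, key x < N) (τ : Config (boundary Λ)) (f : Config Λ → ℝ) :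
    ∑ σ, ∑ η, gibbs β Λ τ σ * gibbs β Λ τ η * (f η - f σ) ^ 2
      ≤ N * Real.exp (16 * β * w) * (1 + Real.exp (16 * β)) *
        ∑ σ, ∑ η, gibbs β Λ τ σ * generator β Λ τ σ η * (f η - f σ) ^ 2 := by
  rw [mul_assoc _ (1 + _)]
  exact (variance_le_sum_flip hβ hinj hw hN τ f).trans
    (mul_le_mul_of_nonneg_left (sum_flip_le_dirichlet hβ τ f) (by positivity))

/-! ### Relaxation in rectangles. -/

theorem mem_rect {w h : ℕ} {x : Site} :
    x ∈ rect w h ↔ (1 ≤ x.1 ∧ x.1 ≤ w) ∧ 1 ≤ x.2 ∧ x.2 ≤ h := by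
  simp [rect, Finset.mem_product, Finset.mem_Icc]

theorem card_rect (w h : ℕ) : (rect w h).card = w * h := by
  simp [rect]

/-- The row by row enumeration of a rectangle. -/
def rowKey (w h : ℕ) (x : rect w h) : ℕ := x.1.1.toNat + w * x.1.2.toNat

/-- Columns range over 1, …, w, so they differ by less than w and cannot compensate for a change of
row. -/
theorem rowKey_injective (w h : ℕ) : Function.Injective (rowKey w h) := by
  rintro ⟨⟨a, b⟩, hx⟩ ⟨⟨c, d⟩, hy⟩ hxy
  obtain ⟨⟨ha, ha'⟩, hb, -⟩ := mem_rect.1 hx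
  obtain ⟨⟨hc, hc'⟩, hd, -⟩ := mem_rect.1 hy
  simp only [rowKey] at hxy ha ha' hb hc hc' hd
  lift a to ℕ using by omega
  lift b to ℕ using by omega
  lift c to ℕ using by omega
  lift d to ℕ using by omega
  simp only [Int.toNat_natCast] at hxy
  norm_cast at ha ha' hc hc'
  have hbd : b = d := by
    rcases lt_trichotomy b d with hlt | heq | hlt
    · have := Nat.mul_le_mul_left w (Nat.succ_le_of_lt hlt)
      rw [Nat.mul_succ] at this
      omega
    · exact heq
    · have := Nat.mul_le_mul_left w (Nat.succ_le_of_lt hlt)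
      rw [Nat.mul_succ] at this
      omega
  subst hbd
  have : a = c := by omega
  subst this
  rfl

theorem rowKey_lt (w h : ℕ) (x : rect w h) : rowKey w h x < w + w * h + 1 := by
  obtain ⟨⟨h1, h2⟩, h3, h4⟩ := mem_rect.1 x.2
  have := Nat.mul_le_mul_left w (show x.1.2.toNat ≤ h by omega)
  unfold rowKey
  omega

theorem rowKey_le_of_mem_nbrs {w h : ℕ} (x y : rect w h) (hxy : (y : Site) ∈ nbrs x) :
    rowKey w h y ≤ rowKey w h x + w := by
  obtain ⟨⟨a, b⟩, hx⟩ := x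
  obtain ⟨⟨c, d⟩, hy⟩ := y
  obtain ⟨⟨ha, ha'⟩, hb, -⟩ := mem_rect.1 hx
  obtain ⟨⟨hc, hc'⟩, hd, -⟩ := mem_rect.1 hy
  simp only [nbrs, Finset.mem_insert, Finset.mem_singleton, Prod.mk.injEq] at hxy
  simp only at ha ha' hb hc hc' hd
  simp only [rowKey]
  have key : c.toNat ≤ a.toNat + w ∧ d.toNat = b.toNat ∨
      c.toNat = a.toNat ∧ d.toNat ≤ b.toNat + 1 := by omega
  rcases key with ⟨h1, h2⟩ | ⟨h1, h2⟩
  · rw [h2]; omega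
  · have := Nat.mul_le_mul_left w h2
    rw [Nat.mul_succ] at this
    omega

/-- Relaxation to equilibrium in a rectangle, uniformly in the initial and boundary conditions. -/
theorem tvDist_law_rect_le (hβ : 0 ≤ β) (w h : ℕ) (τ : Config (boundary (rect w h))) {t : ℝ}
    (ht : 0 ≤ t) (σ : Config (rect w h)) :
    tvDist (law β (rect w h) τ t σ) (gibbs β (rect w h) τ) ≤ 1 / 2 *
      Real.exp (-(t / (((w + w * h + 1 : ℕ) : ℝ) * Real.exp (16 * β * w)
        * (1 + Real.exp (16 * β)))) + (1 + 12 * β) * (w * h)) := by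
  have hK : (0 : ℝ) < ((w + w * h + 1 : ℕ) : ℝ) * Real.exp (16 * β * w)
      * (1 + Real.exp (16 * β)) := by positivity
  refine (tvDist_exp_smul_le (gibbs_pos β _ τ) (sum_gibbs β _ τ) sum_generator
    gibbs_mul_generator_comm hK (poincare hβ (rowKey_injective w h) rowKey_le_of_mem_nbrs
      (rowKey_lt w h) τ) ht σ).trans ?_
  rw [Real.exp_add]
  refine mul_le_mul_of_nonneg_left (mul_le_mul_of_nonneg_left ?_ (Real.exp_pos _).le)
    (by norm_num)
  have h1 := one_div_gibbs_le hβ τ σ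
  rw [card_rect, Nat.cast_mul] at h1
  have hA : (1 : ℝ) ≤ Real.exp ((1 + 12 * β) * (w * h)) := Real.one_le_exp (by positivity)
  -- The square root is not needed: it is given up through A ≤ A² for A ≥ 1.
  calc √(1 / gibbs β (rect w h) τ σ) ≤ √(Real.exp ((1 + 12 * β) * (w * h)) ^ 2) :=
        Real.sqrt_le_sqrt (h1.trans (le_self_pow₀ hA two_ne_zero))
    _ = _ := Real.sqrt_sq (by positivity)

/-- An integer `m` above all the exponents makes the bound uniform in ε; `x ≤ 3 * L` covers both L
and 2L + 1. The extra e^L absorbs the rounding. -/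
theorem natCeil_rpow_le {ε₀ ε : ℝ} {m : ℕ} (hm : 1 / 2 + ε₀ ≤ m) (hε : ε ≤ ε₀) {x : ℝ} {L : ℕ}
    (hL : 1 ≤ L) (hx : 1 ≤ x) (hxL : x ≤ 3 * L) :
    (⌈x ^ (1 / 2 + ε)⌉₊ : ℝ) ≤ Real.exp ((3 * m + 1) * L) := by
  have hL' : (1 : ℝ) ≤ L := by exact_mod_cast hL
  have h1 : x ^ (1 / 2 + ε) ≤ Real.exp (3 * m * L) := by
    calc x ^ (1 / 2 + ε) ≤ x ^ (m : ℝ) := Real.rpow_le_rpow_of_exponent_le hx (by linarith)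
      _ = x ^ m := Real.rpow_natCast _ _
      _ ≤ Real.exp (3 * L) ^ m := by
          refine pow_le_pow_left₀ (by linarith) ?_ _
          linarith [Real.add_one_le_exp (3 * (L : ℝ))]
      _ = Real.exp (3 * m * L) := by rw [← Real.exp_nat_mul]; ring_nf
  have h2 := (Nat.ceil_lt_add_one (Real.rpow_nonneg (by linarith : 0 ≤ x) (1 / 2 + ε))).le
  have h3 : (1 : ℝ) ≤ Real.exp (3 * m * L) := Real.one_le_exp (by positivity)
  have h4 : (2 : ℝ) ≤ Real.exp L := by linarith [Real.add_one_le_exp (L : ℝ)]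
  have h5 : Real.exp ((3 * m + 1) * L) = Real.exp (3 * m * L) * Real.exp L := by
    rw [← Real.exp_add]; ring_nf
  rw [h5]
  nlinarith

/-- A rectangle of base `L` and height at most exponential in `L` relaxes in a time exponential
in `L`. -/
theorem exists_tvDist_law_rect_le (hβ : 0 ≤ β) (a : ℕ) :
    ∃ c : ℝ, 0 < c ∧ ∀ L h : ℕ, 1 ≤ L → (h : ℝ) ≤ Real.exp (a * L) →
      ∀ (τ : Config (boundary (rect L h))) (t : ℝ), Real.exp (c * L) ≤ t →
        ∀ σ : Config (rect L h), tvDist (law β (rect L h) τ t σ) (gibbs β (rect L h) τ)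
          ≤ 1 / 2 * Real.exp (-(t * Real.exp (-(c * L)))) := by
  -- e^{bL} bounds the Poincaré constant: 3 + a for the number of steps, 16β for the cut, 1 + 16β
  -- for the flip rate. Below, e^{dL} bounds the logarithm of the initial factor.
  obtain ⟨b, hb⟩ : ∃ b : ℝ, b = 3 + a + 16 * β + (1 + 16 * β) := ⟨_, rfl⟩
  obtain ⟨d, hd⟩ : ∃ d : ℝ, d = (1 + 12 * β) + 1 + a := ⟨_, rfl⟩
  have hd0 : 0 ≤ d := by rw [hd]; positivity
  refine ⟨b + d + 1, by rw [hb]; positivity, fun L h hL hh τ t ht σ => ?_⟩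
  have hL' : (1 : ℝ) ≤ L := by exact_mod_cast hL
  have ht0 : 0 ≤ t := (Real.exp_pos _).le.trans ht
  refine (tvDist_law_rect_le hβ L h τ ht0 σ).trans
    (mul_le_mul_of_nonneg_left (Real.exp_le_exp.2 ?_) (by norm_num))
  have hK : ((L + L * h + 1 : ℕ) : ℝ) * Real.exp (16 * β * L) * (1 + Real.exp (16 * β))
      ≤ Real.exp (b * L) := by
    have h1 : ((L + L * h + 1 : ℕ) : ℝ) ≤ Real.exp (3 * L) * Real.exp (a * L) := by
      have h2 : (1 : ℝ) ≤ Real.exp (a * L) := Real.one_le_exp (by positivity)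
      have h3 : 3 * (L : ℝ) ≤ Real.exp (3 * L) := by linarith [Real.add_one_le_exp (3 * (L : ℝ))]
      push_cast
      calc (L + L * h + 1 : ℝ) ≤ L * Real.exp (a * L) + L * Real.exp (a * L)
            + L * Real.exp (a * L) := by
              gcongr
              · nlinarith
              · nlinarith
        _ = 3 * L * Real.exp (a * L) := by ring
        _ ≤ _ := by gcongr
    have h4 : 1 + Real.exp (16 * β) ≤ Real.exp ((1 + 16 * β) * L) := by
      have h5 : (1 : ℝ) ≤ Real.exp (16 * β) := Real.one_le_exp (by positivity)
      have h6 : (2 : ℝ) ≤ Real.exp 1 := by linarith [Real.add_one_le_exp 1]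
      calc 1 + Real.exp (16 * β) ≤ Real.exp 1 * Real.exp (16 * β) := by nlinarith
        _ = Real.exp (1 + 16 * β) := (Real.exp_add _ _).symm
        _ ≤ _ := Real.exp_le_exp.2 (by nlinarith)
    calc _ ≤ Real.exp (3 * L) * Real.exp (a * L) * Real.exp (16 * β * L)
          * Real.exp ((1 + 16 * β) * L) := by gcongr
      _ = Real.exp (b * L) := by
          rw [← Real.exp_add, ← Real.exp_add, ← Real.exp_add, hb]; ring_nf
  have hD : (1 + 12 * β) * (L * h) ≤ Real.exp (d * L) := by
    have h1 : (1 + 12 * β) ≤ Real.exp ((1 + 12 * β) * L) := by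
      have := Real.add_one_le_exp ((1 + 12 * β) * L)
      nlinarith
    have h2 : (L : ℝ) ≤ Real.exp L := by linarith [Real.add_one_le_exp (L : ℝ)]
    calc (1 + 12 * β) * (L * h) ≤ Real.exp ((1 + 12 * β) * L)
          * (Real.exp L * Real.exp (a * L)) := by gcongr
      _ = Real.exp (d * L) := by rw [← Real.exp_add, ← Real.exp_add, hd]; ring_nf
  have hrate : t * Real.exp (-(b * L))
      ≤ t / (((L + L * h + 1 : ℕ) : ℝ) * Real.exp (16 * β * L) * (1 + Real.exp (16 * β))) := by
    rw [Real.exp_neg, ← div_eq_mul_inv]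
    exact div_le_div_of_nonneg_left ht0 (by positivity) hK
  -- Lowering the rate from e^{-bL} to e^{-cL} with c = b + d + 1 frees enough decay to pay for the
  -- initial factor: once t ≥ e^{cL}, the gain is at least e^{(d+1)L} - 1 ≥ e^{dL}.
  have hgap : Real.exp (d * L) ≤ t * (Real.exp (-(b * L)) - Real.exp (-((b + d + 1) * L))) := by
    have h1 : Real.exp (-((b + d + 1) * L)) ≤ Real.exp (-(b * L)) :=
      Real.exp_le_exp.2 (by nlinarith)
    refine le_trans ?_ (mul_le_mul_of_nonneg_right ht (sub_nonneg.2 h1))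
    rw [mul_sub, ← Real.exp_add, ← Real.exp_add, add_neg_cancel, Real.exp_zero,
      show (b + d + 1) * L + -(b * L) = d * L + L by ring, Real.exp_add]
    have h2 : (1 : ℝ) ≤ Real.exp (d * L) := Real.one_le_exp (by positivity)
    have h3 : (2 : ℝ) ≤ Real.exp L := by linarith [Real.add_one_le_exp (L : ℝ)]
    nlinarith
  rw [mul_sub] at hgap
  linarith

theorem mixingTime_le {Λ : Finset Site} {τ : Config (boundary Λ)} {t : ℝ} (ht : 0 < t)
    (h : ∀ σ : Config Λ, tvDist (law β Λ τ t σ) (gibbs β Λ τ) ≤ 1 / (2 * Real.exp 1)) :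
    mixingTime β Λ τ ≤ ENNReal.ofReal t :=
  sInf_le ⟨t, ⟨ht, h⟩, rfl⟩

theorem inductiveStatement_of_forall_le {w h : ℕ} {t δ : ℝ}
    (hle : ∀ (τ : Config (boundary (rect w h))) (σ : Config (rect w h)),
      tvDist (law β (rect w h) τ t σ) (gibbs β (rect w h) τ) ≤ δ) :
    inductiveStatement β w h t δ := by
  rintro P ⟨hP, -, -⟩ s
  calc _ ≤ ∫ _τ, δ ∂P :=
        integral_mono (.of_finite) (integrable_const δ) fun τ => hle τ _
    _ = δ := by simp

end Ising

/-! ### Conclusion for both rectangles. -/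

theorem mainTheorem7 (β : ℝ) (hβ : 0 ≤ β) (ε₀ : ℝ) (hε₀ : 0 < ε₀) :
    ∃ c : ℝ, 0 < c ∧ ∀ ε : ℝ, 0 < ε → ε ≤ ε₀ → ∀ L : ℕ, 1 ≤ L →
      (∀ τ : Ising.Config (Ising.boundary (Ising.rectR ε L)),
        Ising.mixingTime β (Ising.rectR ε L) τ ≤ ENNReal.ofReal (Real.exp (c * L))) ∧
      (∀ τ : Ising.Config (Ising.boundary (Ising.rectQ ε L)),
        Ising.mixingTime β (Ising.rectQ ε L) τ ≤ ENNReal.ofReal (Real.exp (c * L))) ∧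
      ∀ t : ℝ, Real.exp (c * L) ≤ t →
        Ising.statementA β ε L t (Real.exp (-(t * Real.exp (-(c * L))))) ∧
        Ising.statementB β ε L t (Real.exp (-(t * Real.exp (-(c * L))))) := by
  obtain ⟨m, hm⟩ := exists_nat_ge (1 / 2 + ε₀)
  obtain ⟨c, hc, hrect⟩ := Ising.exists_tvDist_law_rect_le hβ (3 * m + 1)
  refine ⟨c, hc, fun ε _ hε L hL => ?_⟩
  have hL' : (1 : ℝ) ≤ L := by exact_mod_cast hL
  have hR : (Ising.heightR ε L : ℝ) ≤ Real.exp ((3 * m + 1 : ℕ) * L) := by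
    push_cast
    exact Ising.natCeil_rpow_le hm hε hL hL' (by linarith)
  have hQ : (Ising.heightQ ε L : ℝ) ≤ Real.exp ((3 * m + 1 : ℕ) * L) := by
    push_cast
    exact Ising.natCeil_rpow_le hm hε hL (by linarith) (by linarith)
  have hmix (h : ℕ) (hh : (h : ℝ) ≤ Real.exp ((3 * m + 1 : ℕ) * L))
      (τ : Ising.Config (Ising.boundary (Ising.rect L h))) :
      Ising.mixingTime β (Ising.rect L h) τ ≤ ENNReal.ofReal (Real.exp (c * L)) := by
    refine Ising.mixingTime_le (Real.exp_pos _) fun σ => ?_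
    -- At t = e^{cL} the bound is exactly 1/(2e), the threshold of the mixing time; hence the
    -- prefactor 1/2 was kept.
    refine (hrect L h hL hh τ _ le_rfl σ).trans (le_of_eq ?_)
    rw [← Real.exp_add, add_neg_cancel, Real.exp_zero, Real.exp_neg, one_div_mul_eq_div,
      div_eq_mul_inv, one_div, mul_inv, mul_comm]
  have hind (h : ℕ) (hh : (h : ℝ) ≤ Real.exp ((3 * m + 1 : ℕ) * L)) (t : ℝ)
      (ht : Real.exp (c * L) ≤ t) :
      Ising.inductiveStatement β L h t (Real.exp (-(t * Real.exp (-(c * L))))) :=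
    Ising.inductiveStatement_of_forall_le fun τ σ =>
      (hrect L h hL hh τ t ht σ).trans (by
        linarith [Real.exp_pos (-(t * Real.exp (-(c * L))))])
  exact ⟨hmix _ hR, hmix _ hQ, fun t ht => ⟨hind _ hR t ht, hind _ hQ t ht⟩⟩
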